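/- Let $S$ and $T$ be semigroups and let $S*T$ be their free product (the coproduct in the category of semigroups). For a semigroup $U$, a $U$-module is an abelian group $A$ with a map $U\times A\to A$, $(u,a)\mapsto ua$, such that $u(a+b)=ua+ub$ and $u(va)=(uv)a$ for all $u,v\in U$, $a,b\in A$. Let $C^n(U,A)$ be the group of all maps $U^n\to A$ and let $\partial^n\colon C^n(U,A)\to C^{n+1}(U,A)$ be given by $$\partial^n f(x_1,\dots,x_{n+1})=x_1f(x_2,\dots,x_{n+1})+\sum_{i=1}^n(-1)^i f(x_1,\dots,x_ix_{i+1},\dots,x_{n+1})+(-1)^{n+1}f(x_1,\dots,x_n),$$ and let $H^n(U,A)=\operatorname{Ker}\partial^n/\operatorname{Im}\partial^{n-1}$ be the $n$-th (Eilenberg–MacLane) cohomology group for $n\ge 1$. Then for every $n\ge 2$ and every $(S*T)$-module $A$ there is an isomorphism of abelian groups $$H^n(S*T,A)\cong H^n(S,A)\oplus H^n(T,A),$$ where $A$ is regarded as an $S$-module and as a $T$-module through the canonical homomorphisms $S\to S*T$ and $T\to S*T$. -/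

import Mathlib

namespace EMCohomology

/-- The defining relations of the free product of two semigroups, on words over the disjoint
union of `S` and `T`: a product of two letters of one factor is the letter of their product. -/
inductive FreeProductRel (S T : Type*) [Semigroup S] [Semigroup T] :
    FreeSemigroup (S ⊕ T) → FreeSemigroup (S ⊕ T) → Prop
  | inl (s s' : S) : FreeProductRel S T
      (FreeSemigroup.of (Sum.inl s) * FreeSemigroup.of (Sum.inl s'))
      (FreeSemigroup.of (Sum.inl (s * s')))
  | inr (t t' : T) : FreeProductRel S T
      (FreeSemigroup.of (Sum.inr t) * FreeSemigroup.of (Sum.inr t'))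
      (FreeSemigroup.of (Sum.inr (t * t')))

/-- The free product `S * T` of two semigroups (their coproduct in the category of semigroups):
the free semigroup on the disjoint union of `S` and `T`, modulo the congruence generated by the
multiplication tables of `S` and of `T`. No identity element is adjoined or identified. -/
abbrev FreeProduct (S T : Type*) [Semigroup S] [Semigroup T] : Type _ :=
  (conGen (FreeProductRel S T)).Quotient

/-- The canonical homomorphism `S → S * T`. -/
def FreeProduct.inl (S T : Type*) [Semigroup S] [Semigroup T] : S →ₙ* FreeProduct S T where
  toFun s := ((FreeSemigroup.of (Sum.inl s) : FreeSemigroup (S ⊕ T)) : FreeProduct S T)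
  map_mul' s s' :=
    ((Con.eq _).2 (ConGen.Rel.of _ _ (FreeProductRel.inl (T := T) s s'))).symm

/-- The canonical homomorphism `T → S * T`. -/
def FreeProduct.inr (S T : Type*) [Semigroup S] [Semigroup T] : T →ₙ* FreeProduct S T where
  toFun t := ((FreeSemigroup.of (Sum.inr t) : FreeSemigroup (S ⊕ T)) : FreeProduct S T)
  map_mul' t t' :=
    ((Con.eq _).2 (ConGen.Rel.of _ _ (FreeProductRel.inr (S := S) t t'))).symm

/-- A (left) `S`-module structure on the abelian group `A`: every `s : S` acts by an additive
endomorphism `a ↦ ρ s a`, and `ρ (s * t) a = ρ s (ρ t a)`. If `S` happens to have an identity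
element, it is not required to act as the identity. -/
abbrev ModuleStructure (S A : Type*) [Semigroup S] [AddCommGroup A] : Type _ :=
  S →ₙ* AddMonoid.End A

section Cohomology

variable {S A : Type*} [Semigroup S] [AddCommGroup A]

/-- The coboundary operator `∂ⁿ : Cⁿ(S, A) → Cⁿ⁺¹(S, A)`, where `Cⁿ(S, A)` is the group of all
`n`-place maps from `S` to `A`:
`∂ⁿ f (x₁, …, xₙ₊₁) = x₁ f (x₂, …, xₙ₊₁) + ∑ᵢ₌₁ⁿ (-1)ⁱ f (x₁, …, xᵢ xᵢ₊₁, …, xₙ₊₁)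
  + (-1)ⁿ⁺¹ f (x₁, …, xₙ)`.
Indices start at `0` in the code; `Fin.contractNth j (· * ·) x` replaces the two
neighbouring entries `x j`, `x (j + 1)` by their product. -/
def coboundary (ρ : ModuleStructure S A) (n : ℕ) :
    ((Fin n → S) → A) →+ ((Fin (n + 1) → S) → A) where
  toFun f x :=
    ρ (x 0) (f fun i => x i.succ)
      + ∑ j : Fin n, (-1 : ℤ) ^ ((j : ℕ) + 1) • f (Fin.contractNth j.castSucc (· * ·) x)
      + (-1 : ℤ) ^ (n + 1) • f fun i => x i.castSucc
  map_zero' := by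
    funext x
    simp
  map_add' f g := by
    funext x
    simp only [Pi.add_apply, map_add, smul_add, Finset.sum_add_distrib]
    abel

/-- The group `Zⁿ(S, A) = Ker ∂ⁿ` of `n`-dimensional cocycles. -/
def cocycles (ρ : ModuleStructure S A) (n : ℕ) : AddSubgroup ((Fin n → S) → A) :=
  (coboundary ρ n).ker

/-- The group `Bⁿ(S, A) = Im ∂ⁿ⁻¹` of `n`-dimensional coboundaries, with `B⁰(S, A) = 0`. -/
def coboundaries (ρ : ModuleStructure S A) : (n : ℕ) → AddSubgroup ((Fin n → S) → A)
  | 0 => ⊥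
  | n + 1 => (coboundary ρ n).range

/-- The Eilenberg–MacLane cohomology group `Hⁿ(S, A) = Zⁿ(S, A) / Bⁿ(S, A)`. -/
abbrev Cohomology (ρ : ModuleStructure S A) (n : ℕ) : Type _ :=
  cocycles ρ n ⧸ (coboundaries ρ n).addSubgroupOf (cocycles ρ n)

end Cohomology

end EMCohomology

/-!
Let `B` be the cokernel of the embedding of a `U`-module `A` into the coinduced module of maps
`U¹ → A`, sending `a` to `y ↦ y a`. If `S → U` makes `U¹` a free right `S¹`-set, then the coinduced
module has no cohomology over `S` in positive degrees, and dimension shifting gives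
`Hⁿ⁺¹(S, B) ≃ Hⁿ⁺²(S, A)`. For `U = S * T` this applies to `S`, to `T` and to `U` itself, and
shifting commutes with restriction. So one may replace `A` by `B` and lower the degree until it is
one.

In degree one, a derivation of `S * T` is the same as a pair of derivations of `S` and `T`, which
makes restriction onto. The kernel of restriction consists of the classes of derivations that are
principal on each factor, given by `a` on `S` and by `b` on `T`; such a derivation is principal
once `a - b` is the sum of an `S`-invariant and a `T`-invariant element. In `B` every element is
such a sum.
-/

namespace EMCohomology

namespace FreeProduct

variable {S T : Type*} [Semigroup S] [Semigroup T]

theorem induction_on {P : FreeProduct S T → Prop} (u : FreeProduct S T)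
    (inl : ∀ s, P (inl S T s)) (inr : ∀ t, P (inr S T t))
    (mul : ∀ u v, P u → P v → P (u * v)) : P u := by
  induction u using Con.induction_on with
  | _ w =>
    induction w using FreeSemigroup.recOnMul with
    | ih1 x => exact x.casesOn inl inr
    | ih2 x w hx hw => exact mul _ _ hx hw

variable {M : Type*} [Semigroup M] (f : S →ₙ* M) (g : T →ₙ* M)

theorem conGen_le_ker_lift :
    conGen (FreeProductRel S T) ≤ Con.ker (FreeSemigroup.lift (Sum.elim f g)) := by
  refine Con.conGen_le.2 ?_
  rintro _ _ (⟨s, s'⟩ | ⟨t, t'⟩) <;> simp [Con.ker_rel]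

/-- The homomorphism out of the free product given by its universal property. -/
def lift : FreeProduct S T →ₙ* M where
  toFun u := Con.liftOn u (FreeSemigroup.lift (Sum.elim f g))
    fun _ _ h => conGen_le_ker_lift f g h
  map_mul' u v := Con.induction_on₂ u v fun w w' => map_mul (FreeSemigroup.lift _) w w'

@[simp] theorem lift_inl (s : S) : lift f g (inl S T s) = f s := rfl

@[simp] theorem lift_inr (t : T) : lift f g (inr S T t) = g t := rfl

end FreeProduct

/-- A decomposition `y = base y * ι (part y)` compatible with right multiplication by `S`, as given
by a basis of `U¹` as a free right `S¹`-set: `base y` represents the `S¹`-orbit of `y`, and `part y`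
is the coordinate of `y` in that orbit. The identity `part (base y) = 1` is not imposed, only
`part 1 = 1`. -/
structure RightCoords {S U : Type*} [Semigroup S] [Semigroup U] (ι : S →ₙ* U) where
  base : WithOne U → WithOne U
  part : WithOne U → WithOne S
  base_one : base 1 = 1
  part_one : part 1 = 1
  base_mul (y : WithOne U) (s : S) : base (y * (ι s : U)) = base y
  part_mul (y : WithOne U) (s : S) : part (y * (ι s : U)) = part y * s
  base_mul_part (y : WithOne U) : base y * WithOne.mapMulHom ι (part y) = y

namespace RightCoords

variable {S T U : Type*} [Semigroup S] [Semigroup T] [Semigroup U]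

section

variable {ι : S →ₙ* U} (D : RightCoords ι)

theorem base_coe (s : S) : D.base (ι s : U) = 1 := by
  simpa [D.base_one] using D.base_mul 1 s

theorem part_coe (s : S) : D.part (ι s : U) = s := by
  simpa [D.part_one] using D.part_mul 1 s

theorem base_eq_self {y : WithOne U} (h : D.part y = 1) : D.base y = y := by
  simpa [h] using D.base_mul_part y

theorem base_mul_coe {y : WithOne U} {s : S} (h : D.part y = s) :
    D.base y * (ι s : U) = y := by
  simpa [h] using D.base_mul_part y

end

variable (U) in
/-- The coordinates of `U¹` as a free right `U¹`-set with basis `1`. -/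
protected def id : RightCoords (MulHom.id U) where
  base _ := 1
  part y := y
  base_one := rfl
  part_one := rfl
  base_mul _ _ := rfl
  part_mul _ _ := rfl
  base_mul_part y := by simp

/-- A right action of a semigroup, as a homomorphism. -/
def rightActionHom {X : Type*} (act : X → S → X)
    (act_mul : ∀ x s s', act x (s * s') = act (act x s) s') : S →ₙ* (Function.End X)ᵐᵒᵖ where
  toFun s := MulOpposite.op fun x => act x s
  map_mul' s s' := MulOpposite.unop_injective <| funext fun x => act_mul x s s'

/-- The element of `U¹` encoded by a pair (orbit representative, coordinate). -/
def word (ι : S →ₙ* U) (x : WithOne U × WithOne S) : WithOne U :=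
  x.1 * WithOne.mapMulHom ι x.2

variable (S U) in
/-- The right action of `S` on pairs (orbit representative, coordinate): `s` multiplies the
coordinate. -/
def appendAction : S →ₙ* (Function.End (WithOne U × WithOne S))ᵐᵒᵖ :=
  rightActionHom (fun x s => (x.1, x.2 * s)) fun x s s' => by simp [mul_assoc]

/-- The right action of the other free factor on pairs (orbit representative, coordinate): `t`
makes the whole word, followed by `t`, the representative of a new orbit. -/
def resetAction (ι : S →ₙ* U) (κ : T →ₙ* U) : T →ₙ* (Function.End (WithOne U × WithOne S))ᵐᵒᵖ :=
  rightActionHom (fun x t => (word ι x * (κ t : U), 1)) fun x t t' => by simp [word, mul_assoc]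

theorem word_appendAction (ι : S →ₙ* U) (s : S) (x : WithOne U × WithOne S) :
    word ι ((appendAction S U s).unop x) = word ι x * (ι s : U) := by
  change x.1 * WithOne.mapMulHom ι (x.2 * s) = x.1 * WithOne.mapMulHom ι x.2 * (ι s : U)
  rw [map_mul, WithOne.mapMulHom_coe, mul_assoc]

theorem word_resetAction (ι : S →ₙ* U) (κ : T →ₙ* U) (t : T) (x : WithOne U × WithOne S) :
    word ι ((resetAction ι κ t).unop x) = word ι x * (κ t : U) :=
  mul_one _

/-- The decomposition of `U¹` read off from the orbit of `(1, 1)` under a right action of `U` on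
pairs (orbit representative, coordinate). -/
def ofAction {ι : S →ₙ* U} (Φ : U →ₙ* (Function.End (WithOne U × WithOne S))ᵐᵒᵖ)
    (hι : ∀ s, Φ (ι s) = appendAction S U s)
    (hΦ : ∀ u x, word ι ((Φ u).unop x) = word ι x * u) : RightCoords ι where
  base y := ((WithOne.lift Φ y).unop (1, 1)).1
  part y := ((WithOne.lift Φ y).unop (1, 1)).2
  base_one := rfl
  part_one := rfl
  base_mul y s := by
    rw [map_mul, WithOne.lift_coe, hι]
    rfl
  part_mul y s := by
    rw [map_mul, WithOne.lift_coe, hι]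
    rfl
  base_mul_part y := by
    refine WithOne.cases_on y ?_ fun u => ?_
    · exact mul_one 1
    · simpa [word] using hΦ u (1, 1)

end RightCoords

namespace FreeProduct

variable {S T : Type*} [Semigroup S] [Semigroup T]

theorem word_unop_apply {R : Type*} [Semigroup R] {ι : R →ₙ* FreeProduct S T}
    {Φ : FreeProduct S T →ₙ* (Function.End (WithOne (FreeProduct S T) × WithOne R))ᵐᵒᵖ}
    (hS : ∀ s x, RightCoords.word ι ((Φ (inl S T s)).unop x) = RightCoords.word ι x * inl S T s)
    (hT : ∀ t x, RightCoords.word ι ((Φ (inr S T t)).unop x) = RightCoords.word ι x * inr S T t)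
    (u : FreeProduct S T) (x : WithOne (FreeProduct S T) × WithOne R) :
    RightCoords.word ι ((Φ u).unop x) = RightCoords.word ι x * u := by
  induction u using FreeProduct.induction_on generalizing x with
  | inl s => exact hS s x
  | inr t => exact hT t x
  | mul u v hu hv =>
    rw [map_mul, WithOne.coe_mul, ← mul_assoc, ← hu]
    exact hv _

variable (S T)

/-- The coordinates of `(S * T)¹` as a free right `S¹`-set. -/
def rightCoordsInl : RightCoords (inl S T) :=
  .ofAction (lift (RightCoords.appendAction S _) (RightCoords.resetAction (inl S T) (inr S T)))
    (fun _ => lift_inl ..)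
    (word_unop_apply (RightCoords.word_appendAction _) (RightCoords.word_resetAction _ _))

/-- The coordinates of `(S * T)¹` as a free right `T¹`-set. -/
def rightCoordsInr : RightCoords (inr S T) :=
  .ofAction (lift (RightCoords.resetAction (inr S T) (inl S T)) (RightCoords.appendAction T _))
    (fun _ => lift_inr ..)
    (word_unop_apply (RightCoords.word_resetAction _ _) (RightCoords.word_appendAction _))

end FreeProduct

theorem cons_castSucc {X : Type*} (n : ℕ) (y : X) (x : Fin (n + 1) → X) :
    (fun i : Fin (n + 1) => (Fin.cons y x : Fin (n + 2) → X) i.castSucc) =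
      Fin.cons y fun i : Fin n => x i.castSucc := by
  funext k
  refine Fin.cases rfl (fun k => ?_) k
  simp

section Bar

variable {S A : Type*} [Semigroup S] [AddCommGroup A]

/-- All terms of the coboundary but the first; these do not involve the action. -/
def faceSum (n : ℕ) (f : (Fin n → S) → A) (x : Fin (n + 1) → S) : A :=
  ∑ j : Fin n, (-1 : ℤ) ^ ((j : ℕ) + 1) • f (Fin.contractNth j.castSucc (· * ·) x)
    + (-1 : ℤ) ^ (n + 1) • f fun i => x i.castSucc

theorem coboundary_apply (ρ : ModuleStructure S A) (n : ℕ) (f : (Fin n → S) → A)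
    (x : Fin (n + 1) → S) :
    coboundary ρ n f x = ρ (x 0) (f (Fin.tail x)) + faceSum n f x :=
  add_assoc _ _ _

theorem faceSum_map {B : Type*} [AddCommGroup B] (φ : A →+ B) (n : ℕ) (f : (Fin n → S) → A)
    (x : Fin (n + 1) → S) : faceSum n (fun z => φ (f z)) x = φ (faceSum n f x) := by
  simp [faceSum]

theorem faceSum_apply {Y : Type*} (n : ℕ) (f : (Fin n → S) → Y → A)
    (x : Fin (n + 1) → S) (y : Y) : faceSum n f x y = faceSum n (fun z => f z y) x :=
  (faceSum_map (Pi.evalAddMonoidHom (fun _ : Y => A) y) n f x).symm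

theorem contractNth_zero_cons (n : ℕ) (y : S) (x : Fin (n + 1) → S) :
    Fin.contractNth (0 : Fin (n + 2)) (· * ·) (Fin.cons y x : Fin (n + 2) → S) =
      Fin.cons (y * x 0) (Fin.tail x) := by
  funext k
  refine Fin.cases ?_ (fun k => ?_) k
  · simp [Fin.contractNth]
  · simp [Fin.contractNth, Fin.tail]

theorem contractNth_succ_cons (n : ℕ) (y : S) (x : Fin (n + 1) → S) (j : Fin (n + 1)) :
    Fin.contractNth j.succ (· * ·) (Fin.cons y x : Fin (n + 2) → S) =
      Fin.cons y (Fin.contractNth j (· * ·) x) := by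
  funext k
  refine Fin.cases ?_ (fun k => ?_) k
  · simp [Fin.contractNth]
  · simp [Fin.contractNth]

theorem faceSum_cons (n : ℕ) (f : (Fin (n + 1) → S) → A) (y : S) (x : Fin (n + 1) → S) :
    faceSum (n + 1) f (Fin.cons y x) =
      -f (Fin.cons (y * x 0) (Fin.tail x)) - faceSum n (fun z => f (Fin.cons y z)) x := by
  simp only [faceSum, Fin.sum_univ_succ, cons_castSucc, Fin.castSucc_zero, contractNth_zero_cons,
    ← Fin.succ_castSucc, contractNth_succ_cons, Fin.val_zero, Fin.val_succ,
    pow_succ (-1 : ℤ) (_ + 1), mul_neg, mul_one, neg_smul, Finset.sum_neg_distrib, zero_add,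
    pow_one, one_smul]
  abel

theorem coboundary_cons (ρ : ModuleStructure S A) (n : ℕ) (f : (Fin (n + 1) → S) → A) (y : S)
    (x : Fin (n + 1) → S) :
    coboundary ρ (n + 1) f (Fin.cons y x) =
      ρ y (f x) - f (Fin.cons (y * x 0) (Fin.tail x)) -
        faceSum n (fun z => f (Fin.cons y z)) x := by
  rw [coboundary_apply, faceSum_cons, Fin.cons_zero, Fin.tail_cons]
  abel

theorem coboundary_mem_coboundaries (ρ : ModuleStructure S A) (n : ℕ) (f : (Fin n → S) → A) :
    coboundary ρ n f ∈ coboundaries ρ (n + 1) :=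
  ⟨f, rfl⟩

end Bar

namespace Cohomology

section Map

variable {S S' A A' : Type*} [Semigroup S] [Semigroup S'] [AddCommGroup A] [AddCommGroup A']
  {ρ : ModuleStructure S A} {ρ' : ModuleStructure S' A'} {m n : ℕ}

/-- The class of a cocycle. -/
def mk (ρ : ModuleStructure S A) (n : ℕ) : cocycles ρ n →+ Cohomology ρ n :=
  QuotientAddGroup.mk' _

theorem mk_surjective : Function.Surjective (mk ρ n) :=
  QuotientAddGroup.mk'_surjective _

theorem mk_eq_zero_iff (f : cocycles ρ n) : mk ρ n f = 0 ↔ f.1 ∈ coboundaries ρ n :=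
  QuotientAddGroup.eq_zero_iff f

/-- The map on cohomology induced by a homomorphism of cochain groups, possibly of different
degrees, which respects cocycles and coboundaries. -/
def map (φ : ((Fin m → S) → A) →+ ((Fin n → S') → A'))
    (hZ : ∀ f ∈ cocycles ρ m, φ f ∈ cocycles ρ' n)
    (hB : ∀ f ∈ coboundaries ρ m, φ f ∈ coboundaries ρ' n) :
    Cohomology ρ m →+ Cohomology ρ' n :=
  QuotientAddGroup.map _ _
    ((φ.comp (cocycles ρ m).subtype).codRestrict _ fun f => hZ f f.2) fun f => hB f.1

variable {φ : ((Fin m → S) → A) →+ ((Fin n → S') → A')}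
  (hZ : ∀ f ∈ cocycles ρ m, φ f ∈ cocycles ρ' n)
  (hB : ∀ f ∈ coboundaries ρ m, φ f ∈ coboundaries ρ' n)

theorem map_bijective_of
    (inj : ∀ f ∈ cocycles ρ m, φ f ∈ coboundaries ρ' n → f ∈ coboundaries ρ m)
    (surj : ∀ g ∈ cocycles ρ' n, ∃ f ∈ cocycles ρ m, φ f = g) :
    Function.Bijective (map φ hZ hB) := by
  refine ⟨(injective_iff_map_eq_zero _).2 fun a ha => ?_, fun b => ?_⟩
  · obtain ⟨f, rfl⟩ := mk_surjective a
    exact (mk_eq_zero_iff _).2 (inj f.1 f.2 ((mk_eq_zero_iff _).1 ha))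
  · obtain ⟨⟨g, hg⟩, rfl⟩ := mk_surjective b
    obtain ⟨f, hf, rfl⟩ := surj g hg
    exact ⟨mk ρ m ⟨f, hf⟩, rfl⟩

end Map

end Cohomology

section Restriction

variable {U S A : Type*} [Semigroup U] [Semigroup S] [AddCommGroup A]
  (ρ : ModuleStructure U A) (ι : S →ₙ* U)

/-- Restriction of cochains along a homomorphism of semigroups. -/
def restrictCochain (n : ℕ) : ((Fin n → U) → A) →+ ((Fin n → S) → A) where
  toFun f x := f (ι ∘ x)
  map_zero' := rfl
  map_add' _ _ := rfl

theorem restrictCochain_apply (n : ℕ) (f : (Fin n → U) → A) (x : Fin n → S) :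
    restrictCochain ι n f x = f (ι ∘ x) := rfl

theorem coboundary_restrictCochain (n : ℕ) (f : (Fin n → U) → A) :
    coboundary (ρ.comp ι) n (restrictCochain ι n f) =
      restrictCochain ι (n + 1) (coboundary ρ n f) := by
  funext x
  simp only [coboundary_apply, faceSum, restrictCochain_apply,
    Fin.comp_contractNth (· * ·) (· * ·) (map_mul ι)]
  rfl

theorem restrictCochain_mem_cocycles {n : ℕ} {f : (Fin n → U) → A}
    (hf : f ∈ cocycles ρ n) : restrictCochain ι n f ∈ cocycles (ρ.comp ι) n := by
  rw [cocycles, AddMonoidHom.mem_ker] at hf ⊢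
  rw [coboundary_restrictCochain, hf, map_zero]

theorem restrictCochain_mem_coboundaries {n : ℕ} {f : (Fin n → U) → A}
    (hf : f ∈ coboundaries ρ n) :
    restrictCochain ι n f ∈ coboundaries (ρ.comp ι) n := by
  cases n with
  | zero => rw [AddSubgroup.mem_bot.1 hf, map_zero]; exact zero_mem _
  | succ n =>
    obtain ⟨g, rfl⟩ := hf
    rw [← coboundary_restrictCochain]
    exact coboundary_mem_coboundaries ..

/-- Restriction of cohomology classes along a homomorphism of semigroups. -/
def Cohomology.restrict (n : ℕ) :
    Cohomology ρ n →+ Cohomology (ρ.comp ι) n :=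
  Cohomology.map (restrictCochain ι n) (fun _ => restrictCochain_mem_cocycles ρ ι)
    fun _ => restrictCochain_mem_coboundaries ρ ι

end Restriction

section EvalWithOne

variable {U A : Type*} [AddCommGroup A]

/-- Evaluation of a map on `U`, extended by `0` to `U¹`. -/
def evalWithOne (y : WithOne U) : (U → A) →+ A :=
  WithOne.recOneCoe 0 (fun u => Pi.evalAddMonoidHom (fun _ : U => A) u) y

@[simp] theorem evalWithOne_one (h : U → A) : evalWithOne 1 h = 0 := rfl

@[simp] theorem evalWithOne_coe (u : U) (h : U → A) : evalWithOne (u : WithOne U) h = h u := rfl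

end EvalWithOne

section Shift

variable {U A : Type*} [Semigroup U] [AddCommGroup A]

/-- The cokernel of the canonical embedding of `A` into the coinduced module of maps `U¹ → A`,
realised on the maps `U → A`. -/
def shiftModule (ρ : ModuleStructure U A) : ModuleStructure U (U → A) where
  toFun u :=
    { toFun := fun h y => h (y * u) - ρ y (h u)
      map_zero' := by
        funext y
        simp
      map_add' := fun h h' => by
        funext y
        simp only [Pi.add_apply, map_add]
        abel }
  map_mul' u v := by
    ext h y
    change h (y * (u * v)) - ρ y (h (u * v)) =
      h (y * u * v) - ρ (y * u) (h v) - ρ y (h (u * v) - ρ u (h v))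
    simp only [map_sub, map_mul, mul_assoc, AddMonoid.End.coe_mul, Function.comp_apply]
    abel

theorem shiftModule_apply (ρ : ModuleStructure U A) (u : U) (h : U → A) (y : U) :
    shiftModule ρ u h y = h (y * u) - ρ y (h u) := rfl

/-- The action of `U¹` on a `U`-module. -/
abbrev ModuleStructure.withOne (ρ : ModuleStructure U A) : WithOne U →* AddMonoid.End A :=
  WithOne.lift ρ

theorem ModuleStructure.withOne_mapMulHom {S : Type*} [Semigroup S] (ρ : ModuleStructure U A)
    (ι : S →ₙ* U) (p : WithOne S) :
    ρ.withOne (WithOne.mapMulHom ι p) = ModuleStructure.withOne (ρ.comp ι) p :=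
  WithOne.cases_on p rfl fun _ => rfl

theorem evalWithOne_shiftModule (ρ : ModuleStructure U A) (u : U) (h : U → A) (y : WithOne U) :
    evalWithOne y (shiftModule ρ u h) =
      evalWithOne (y * (u : WithOne U)) h - ρ.withOne y (h u) := by
  refine WithOne.cases_on y (by simp) fun v => ?_
  rw [← WithOne.coe_mul, evalWithOne_coe, evalWithOne_coe, shiftModule_apply, WithOne.lift_coe]

variable {S : Type*} [Semigroup S] (ρ : ModuleStructure U A) (ι : S →ₙ* U)

/-- Dimension shifting on cochains: the first variable becomes the argument of the value in
`U → A`. It anticommutes with the coboundary. -/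
def shiftUp (n : ℕ) : ((Fin n → S) → U → A) →+ ((Fin (n + 1) → S) → A) where
  toFun F x := F (Fin.tail x) (ι (x 0))
  map_zero' := rfl
  map_add' _ _ := rfl

theorem shiftUp_apply (n : ℕ) (F : (Fin n → S) → U → A) (x : Fin (n + 1) → S) :
    shiftUp ι n F x = F (Fin.tail x) (ι (x 0)) := rfl

theorem shiftUp_cons (n : ℕ) (F : (Fin n → S) → U → A) (s : S) (x : Fin n → S) :
    shiftUp ι n F (Fin.cons s x) = F x (ι s) := rfl

theorem coboundary_shiftUp (n : ℕ) (F : (Fin n → S) → U → A) :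
    coboundary (ρ.comp ι) (n + 1) (shiftUp ι n F) =
      -shiftUp ι (n + 1) (coboundary ((shiftModule ρ).comp ι) n F) := by
  funext x
  rw [← Fin.cons_self_tail x, coboundary_cons, Pi.neg_apply]
  simp only [shiftUp_apply, Fin.cons_zero, Fin.tail_cons, coboundary_apply, Pi.add_apply,
    faceSum_apply, MulHom.comp_apply, shiftModule_apply, map_mul]
  abel

theorem shiftUp_mem_cocycles {n : ℕ} {F : (Fin n → S) → U → A}
    (hF : F ∈ cocycles ((shiftModule ρ).comp ι) n) :
    shiftUp ι n F ∈ cocycles (ρ.comp ι) (n + 1) := by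
  rw [cocycles, AddMonoidHom.mem_ker] at hF ⊢
  rw [coboundary_shiftUp, hF, map_zero, neg_zero]

theorem shiftUp_mem_coboundaries {n : ℕ} {F : (Fin (n + 1) → S) → U → A}
    (hF : F ∈ coboundaries ((shiftModule ρ).comp ι) (n + 1)) :
    shiftUp ι (n + 1) F ∈ coboundaries (ρ.comp ι) (n + 2) := by
  obtain ⟨G, rfl⟩ := hF
  rw [← neg_neg (shiftUp ι (n + 1) _), ← coboundary_shiftUp]
  exact neg_mem (coboundary_mem_coboundaries ..)

/-- Dimension shifting on cohomology. -/
def Cohomology.shift (n : ℕ) :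
    Cohomology ((shiftModule ρ).comp ι) (n + 1) →+ Cohomology (ρ.comp ι) (n + 2) :=
  Cohomology.map (shiftUp ι (n + 1)) (fun _ => shiftUp_mem_cocycles ρ ι)
    fun _ => shiftUp_mem_coboundaries ρ ι

theorem Cohomology.restrict_shift (n : ℕ)
    (a : Cohomology ((shiftModule ρ).comp (MulHom.id U)) (n + 1)) :
    Cohomology.restrict ρ ι (n + 2) (Cohomology.shift ρ (MulHom.id U) n a) =
      Cohomology.shift ρ ι n (Cohomology.restrict (shiftModule ρ) ι (n + 1) a) := by
  obtain ⟨f, rfl⟩ := Cohomology.mk_surjective a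
  rfl

end Shift

namespace RightCoords

variable {S U A : Type*} [Semigroup S] [Semigroup U] [AddCommGroup A] {ι : S →ₙ* U}
  (ρ : ModuleStructure U A)

section

variable (D : RightCoords ι)

/-- The coinduction of a map `S → A` along coordinates of `U¹` over `S¹`, evaluated at a point. -/
def coind (y : WithOne U) : (S → A) →+ A :=
  (ρ.withOne (D.base y)).comp (evalWithOne (D.part y))

theorem coind_apply (y : WithOne U) (c : S → A) :
    D.coind ρ y c = ρ.withOne (D.base y) (evalWithOne (D.part y) c) := rfl

theorem coind_coe (s : S) (c : S → A) : D.coind ρ (ι s : U) c = c s := by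
  rw [coind_apply, D.base_coe, D.part_coe, map_one, evalWithOne_coe, AddMonoid.End.coe_one,
    _root_.id]

theorem coind_shiftModule (u : U) (s : S) (c : S → A) :
    D.coind ρ u (shiftModule (ρ.comp ι) s c) = D.coind ρ (u * ι s : U) c - ρ u (c s) := by
  have hu := congrArg (fun y => ρ.withOne y (c s)) (D.base_mul_part u)
  rw [map_mul, ModuleStructure.withOne_mapMulHom, WithOne.lift_coe] at hu
  rw [coind_apply, evalWithOne_shiftModule, map_sub, coind_apply, WithOne.coe_mul, D.base_mul,
    D.part_mul, ← hu]
  rfl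

/-- The section of `shiftUp` given by coinduction. -/
def shiftDown (n : ℕ) : ((Fin (n + 1) → S) → A) →+ ((Fin n → S) → U → A) where
  toFun f x u := D.coind ρ u fun s => f (Fin.cons s x)
  map_zero' := by
    funext x u
    exact map_zero _
  map_add' f g := by
    funext x u
    exact map_add (D.coind ρ u) (fun s => f (Fin.cons s x)) fun s => g (Fin.cons s x)

theorem shiftDown_apply (n : ℕ) (f : (Fin (n + 1) → S) → A) (x : Fin n → S) (u : U) :
    D.shiftDown ρ n f x u = D.coind ρ u fun s => f (Fin.cons s x) := rfl

theorem shiftUp_shiftDown (n : ℕ) (f : (Fin (n + 1) → S) → A) :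
    shiftUp ι n (D.shiftDown ρ n f) = f := by
  funext x
  rw [← Fin.cons_self_tail x, shiftUp_cons, shiftDown_apply, coind_coe]

theorem coboundary_shiftDown (n : ℕ) (f : (Fin (n + 1) → S) → A) :
    coboundary ((shiftModule ρ).comp ι) n (D.shiftDown ρ n f) =
      -D.shiftDown ρ (n + 1) (coboundary (ρ.comp ι) (n + 1) f) := by
  funext x u
  have hc : (fun s => coboundary (ρ.comp ι) (n + 1) f (Fin.cons s x)) =
      -(shiftModule (ρ.comp ι) (x 0) (fun s => f (Fin.cons s (Fin.tail x))) +
        faceSum n (fun z s => f (Fin.cons s z)) x) := by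
    funext s
    rw [coboundary_cons, Pi.neg_apply, Pi.add_apply, faceSum_apply, shiftModule_apply,
      Fin.cons_self_tail]
    abel
  rw [Pi.neg_apply, Pi.neg_apply, shiftDown_apply, hc, map_neg, neg_neg, map_add,
    coind_shiftModule, ← faceSum_map, coboundary_apply, Pi.add_apply, faceSum_apply,
    MulHom.comp_apply, shiftModule_apply]
  simp only [shiftDown_apply, coind_coe]

theorem shiftDown_mem_cocycles {n : ℕ} {f : (Fin (n + 1) → S) → A}
    (hf : f ∈ cocycles (ρ.comp ι) (n + 1)) :
    D.shiftDown ρ n f ∈ cocycles ((shiftModule ρ).comp ι) n := by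
  rw [cocycles, AddMonoidHom.mem_ker] at hf ⊢
  rw [coboundary_shiftDown, hf, map_zero, neg_zero]

theorem shiftDown_mem_coboundaries {n : ℕ} {f : (Fin (n + 2) → S) → A}
    (hf : f ∈ coboundaries (ρ.comp ι) (n + 2)) :
    D.shiftDown ρ (n + 1) f ∈ coboundaries ((shiftModule ρ).comp ι) (n + 1) := by
  obtain ⟨g, rfl⟩ := hf
  rw [← neg_neg (D.shiftDown ρ (n + 1) _), ← coboundary_shiftDown]
  exact neg_mem (coboundary_mem_coboundaries ..)

/-- The homotopy between the identity and `shiftDown ∘ shiftUp`. It arises by peeling `part u` off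
`u` and using it as the first variable of the cochain. -/
def homotopy (n : ℕ) (F : (Fin (n + 1) → S) → U → A) (x : Fin n → S) (u : U) : A :=
  evalWithOne (D.part u) fun s => evalWithOne (D.base u) (F (Fin.cons s x))

theorem homotopy_of_part_eq_one (n : ℕ) (F : (Fin (n + 1) → S) → U → A) (x : Fin n → S)
    {u : U} (h : D.part u = 1) : D.homotopy n F x u = 0 := by
  simp [homotopy, h]

theorem homotopy_of_part_eq_coe (n : ℕ) (F : (Fin (n + 1) → S) → U → A) (x : Fin n → S)
    {u : U} {s : S} (h : D.part u = s) :
    D.homotopy n F x u = evalWithOne (D.base u) (F (Fin.cons s x)) := by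
  simp [homotopy, h]

theorem eq_shiftDown_shiftUp_add (n : ℕ) {F : (Fin (n + 1) → S) → U → A}
    (hF : F ∈ cocycles ((shiftModule ρ).comp ι) (n + 1)) :
    F = D.shiftDown ρ (n + 1) (shiftUp ι (n + 1) F) +
      coboundary ((shiftModule ρ).comp ι) n (D.homotopy n F) := by
  funext x u
  have hu : D.part (u * ι (x 0) : U) = D.part u * x 0 := by rw [WithOne.coe_mul, D.part_mul]
  have hx : D.homotopy n F (Fin.tail x) (ι (x 0)) = 0 := by
    rw [D.homotopy_of_part_eq_coe n F _ (D.part_coe (x 0)), D.base_coe, evalWithOne_one]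
  rw [Pi.add_apply, Pi.add_apply, coboundary_apply, Pi.add_apply, faceSum_apply,
    MulHom.comp_apply, shiftModule_apply, hx, map_zero, sub_zero, shiftDown_apply, coind_apply]
  simp only [shiftUp_cons]
  cases h : D.part (u : WithOne U) with
  | one =>
    rw [h, one_mul] at hu
    rw [D.homotopy_of_part_eq_coe n F _ hu, WithOne.coe_mul, D.base_mul, D.base_eq_self h,
      Fin.cons_self_tail, evalWithOne_coe]
    simp [D.homotopy_of_part_eq_one n F _ h, faceSum]
  | coe s =>
    rw [h, ← WithOne.coe_mul] at hu
    have hc := congrArg (evalWithOne (D.base u))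
      (congrFun (AddMonoidHom.mem_ker.1 hF) (Fin.cons s x))
    rw [coboundary_cons, MulHom.comp_apply, map_sub, map_sub, evalWithOne_shiftModule,
      D.base_mul_coe h, evalWithOne_coe, Pi.zero_apply, map_zero] at hc
    rw [D.homotopy_of_part_eq_coe n F _ hu, WithOne.coe_mul, D.base_mul, evalWithOne_coe]
    simp only [D.homotopy_of_part_eq_coe n F _ h,
      faceSum_map (evalWithOne (D.base u)) n fun z => F (Fin.cons s z)]
    rw [← sub_eq_zero, ← hc]
    abel

end

theorem mem_coboundaries_of_shiftUp (D : RightCoords ι) {n : ℕ} {F : (Fin (n + 1) → S) → U → A}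
    (hF : F ∈ cocycles ((shiftModule ρ).comp ι) (n + 1))
    (h : shiftUp ι (n + 1) F ∈ coboundaries (ρ.comp ι) (n + 2)) :
    F ∈ coboundaries ((shiftModule ρ).comp ι) (n + 1) := by
  rw [D.eq_shiftDown_shiftUp_add ρ n hF]
  exact add_mem (D.shiftDown_mem_coboundaries ρ h) (coboundary_mem_coboundaries ..)

theorem cohomology_shift_bijective (D : RightCoords ι) (n : ℕ) :
    Function.Bijective (Cohomology.shift ρ ι n) :=
  Cohomology.map_bijective_of _ _ (fun _ hF h => D.mem_coboundaries_of_shiftUp ρ hF h)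
    fun f hf => ⟨D.shiftDown ρ (n + 1) f, D.shiftDown_mem_cocycles ρ hf,
      D.shiftUp_shiftDown ρ (n + 1) f⟩

end RightCoords

theorem const_apply_zero {X : Type*} (x : Fin 1 → X) : (fun _ => x 0) = x :=
  (eq_const_of_unique x).symm

section Derivation

variable {S M : Type*} [Semigroup S] [AddCommGroup M] (ρ : ModuleStructure S M)

/-- Derivations (crossed homomorphisms) from a semigroup to a module over it: the cocycles of
degree one, as functions of one variable. -/
def IsDerivation (d : S → M) : Prop :=
  ∀ s t, d (s * t) = d s + ρ s (d t)

theorem isDerivation_principal (m : M) : IsDerivation ρ fun s => ρ s m - m := by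
  intro s t
  simp only [map_mul, AddMonoid.End.coe_mul, Function.comp_apply, map_sub]
  abel

theorem mem_cocycles_one_iff {f : (Fin 1 → S) → M} :
    f ∈ cocycles ρ 1 ↔ IsDerivation ρ fun s => f fun _ => s := by
  have hcons (s : S) (z : Fin 0 → S) : (Fin.cons s z : Fin 1 → S) = fun _ => s :=
    (const_apply_zero _).symm
  have hf (s : S) (x : Fin 1 → S) : coboundary ρ 1 f (Fin.cons s x) =
      ρ s (f x) - f (fun _ => s * x 0) + f fun _ => s := by
    rw [coboundary_cons, hcons]
    simp [faceSum, hcons]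
  constructor
  · intro h s t
    have := hf s fun _ => t
    rw [AddMonoidHom.mem_ker.1 h, Pi.zero_apply] at this
    rw [← sub_eq_zero, ← neg_eq_zero, this]
    abel
  · intro h
    refine AddMonoidHom.mem_ker.2 (funext fun x => ?_)
    have hx : f (fun _ => x 0 * x 1) = _ := h (x 0) (x 1)
    rw [← Fin.cons_self_tail x, hf, ← const_apply_zero (Fin.tail x), Pi.zero_apply]
    change ρ (x 0) (f fun _ => x 1) - f (fun _ => x 0 * x 1) + f (fun _ => x 0) = 0
    rw [hx]
    abel

theorem mem_coboundaries_one_iff {f : (Fin 1 → S) → M} :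
    f ∈ coboundaries ρ 1 ↔ ∃ m, ∀ s, f (fun _ => s) = ρ s m - m := by
  have hg (g : (Fin 0 → S) → M) (x : Fin 1 → S) :
      coboundary ρ 0 g x = ρ (x 0) (g ![]) - g ![] := by
    rw [coboundary_apply]
    simp [faceSum, Subsingleton.elim _ (![] : Fin 0 → S), sub_eq_add_neg]
  constructor
  · rintro ⟨g, rfl⟩
    exact ⟨g ![], fun s => hg g _⟩
  · rintro ⟨m, hm⟩
    refine ⟨fun _ => m, funext fun x => ?_⟩
    rw [hg, ← hm, const_apply_zero]

variable {ρ}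

/-- The affine action `m ↦ s m + d s` associated with a derivation `d`. -/
def IsDerivation.affineHom {d : S → M} (hd : IsDerivation ρ d) : S →ₙ* Function.End M where
  toFun s m := ρ s m + d s
  map_mul' s t := funext fun m => by
    change ρ (s * t) m + d (s * t) = ρ s (ρ t m + d t) + d s
    rw [map_mul, AddMonoid.End.coe_mul, Function.comp_apply, hd, map_add]
    abel

end Derivation

namespace FreeProduct

variable {S T M : Type*} [Semigroup S] [Semigroup T] [AddCommGroup M]
  {ρ : ModuleStructure (FreeProduct S T) M}

theorem derivation_ext {d e : FreeProduct S T → M} (hd : IsDerivation ρ d)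
    (he : IsDerivation ρ e) (hS : ∀ s, d (inl S T s) = e (inl S T s))
    (hT : ∀ t, d (inr S T t) = e (inr S T t)) (u : FreeProduct S T) : d u = e u := by
  induction u using FreeProduct.induction_on with
  | inl s => exact hS s
  | inr t => exact hT t
  | mul u v hu hv => rw [hd, he, hu, hv]

theorem exists_derivation {f : S → M} {g : T → M}
    (hf : IsDerivation (ρ.comp (inl S T)) f) (hg : IsDerivation (ρ.comp (inr S T)) g) :
    ∃ d, IsDerivation ρ d ∧ (∀ s, d (inl S T s) = f s) ∧ ∀ t, d (inr S T t) = g t := by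
  let Φ : FreeProduct S T →ₙ* Function.End M := lift hf.affineHom hg.affineHom
  have hΦS (s : S) (m : M) : Φ (inl S T s) m = ρ (inl S T s) m + f s := rfl
  have hΦT (t : T) (m : M) : Φ (inr S T t) m = ρ (inr S T t) m + g t := rfl
  have hmul (u v : FreeProduct S T) (m : M) : Φ (u * v) m = Φ u (Φ v m) :=
    congrFun (map_mul Φ u v) m
  have hΦ (u : FreeProduct S T) (m : M) : Φ u m = ρ u m + Φ u 0 := by
    induction u using FreeProduct.induction_on generalizing m with
    | inl s => rw [hΦS, hΦS, map_zero, zero_add]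
    | inr t => rw [hΦT, hΦT, map_zero, zero_add]
    | mul u v hu hv =>
      rw [hmul, hu, hv, hmul, hu (Φ v 0), map_mul, map_add, add_assoc]
      rfl
  refine ⟨fun u => Φ u 0, fun u v => ?_, fun s => ?_, fun t => ?_⟩
  · exact (hmul u v 0).trans ((hΦ u _).trans (add_comm _ _))
  · exact (hΦS s 0).trans (by rw [map_zero, zero_add])
  · exact (hΦT t 0).trans (by rw [map_zero, zero_add])

variable (ρ) in
/-- The property that every element is the sum of an `S`-invariant and a `T`-invariant one. -/
def InvariantsSpan : Prop :=
  ∀ m : M, ∃ p q : M, m = p + q ∧ (∀ s, ρ (inl S T s) p = p) ∧ ∀ t, ρ (inr S T t) q = q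

end FreeProduct

/-- The coinduced module of maps `U¹ → M`, on which `U` acts by translation of the argument. -/
def translationModule (U M : Type*) [Semigroup U] [AddCommGroup M] :
    ModuleStructure U (WithOne U → M) where
  toFun u :=
    { toFun := fun k y => k (y * u)
      map_zero' := rfl
      map_add' := fun _ _ => rfl }
  map_mul' u v := by
    ext k y
    exact congrArg k (mul_assoc y u v).symm

namespace FreeProduct

variable {S T M : Type*} [Semigroup S] [Semigroup T] [AddCommGroup M]
  (ρ : ModuleStructure (FreeProduct S T) M)

theorem invariantsSpan_shiftModule : InvariantsSpan (shiftModule ρ) := by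
  intro h
  obtain ⟨d, hd, hS, hT⟩ := exists_derivation (ρ := translationModule (FreeProduct S T) M)
    (f := 0) (fun _ _ => by simp) (isDerivation_principal _ fun y => evalWithOne y h)
  let p (u : FreeProduct S T) : M := d u 1
  have hp (u v : FreeProduct S T) : p (u * v) = p u + d v u := congrFun (hd u v) 1
  have hpS (s : S) : p (inl S T s) = 0 := congrFun (hS s) 1
  have hdT (t : T) (y : WithOne (FreeProduct S T)) :
      d (inr S T t) y = evalWithOne (y * ((inr S T t : FreeProduct S T) : WithOne _)) h -
        evalWithOne y h := congrFun (hT t) y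
  have hpT (t : T) : p (inr S T t) = h (inr S T t) := by
    simpa using hdT t 1
  refine ⟨p, h - p, (add_sub_cancel p h).symm, fun s => funext fun u => ?_,
    fun t => funext fun u => ?_⟩
  · rw [shiftModule_apply, hp, hpS, hS, Pi.zero_apply, Pi.zero_apply, map_zero, add_zero, sub_zero]
  · simp only [shiftModule_apply, Pi.sub_apply, hp, hdT, hpT, sub_self, map_zero,
      ← WithOne.coe_mul, evalWithOne_coe]
    abel

/-- Restriction of cohomology classes of the free product to its two factors. -/
def restrict (n : ℕ) : Cohomology ρ n →+
    Cohomology (ρ.comp (inl S T)) n × Cohomology (ρ.comp (inr S T)) n :=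
  (Cohomology.restrict ρ (inl S T) n).prod (Cohomology.restrict ρ (inr S T) n)

variable {ρ}

theorem restrict_one_injective (hρ : InvariantsSpan ρ) : Function.Injective (restrict ρ 1) := by
  refine (injective_iff_map_eq_zero _).2 fun c hc => ?_
  obtain ⟨f, rfl⟩ := Cohomology.mk_surjective c
  obtain ⟨hS, hT⟩ := Prod.ext_iff.1 hc
  obtain ⟨a, ha⟩ := (mem_coboundaries_one_iff _).1 ((Cohomology.mk_eq_zero_iff _).1 hS)
  obtain ⟨b, hb⟩ := (mem_coboundaries_one_iff _).1 ((Cohomology.mk_eq_zero_iff _).1 hT)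
  obtain ⟨p, q, hpq, hp, hq⟩ := hρ (a - b)
  have hab : a - p = b + q := by
    rw [sub_eq_iff_eq_add, add_assoc, add_comm q, ← hpq, add_sub_cancel]
  refine (Cohomology.mk_eq_zero_iff _).2 ((mem_coboundaries_one_iff _).2 ⟨a - p, ?_⟩)
  refine derivation_ext ((mem_cocycles_one_iff ρ).1 f.2) (isDerivation_principal ρ (a - p))
    (fun s => (ha s).trans ?_) fun t => (hb t).trans ?_
  · rw [MulHom.comp_apply, map_sub, hp, sub_sub_sub_cancel_right]
  · rw [MulHom.comp_apply, hab, map_add, hq, add_sub_add_right_eq_sub]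

theorem restrict_one_surjective : Function.Surjective (restrict ρ 1) := by
  rintro ⟨a, b⟩
  obtain ⟨f, rfl⟩ := Cohomology.mk_surjective a
  obtain ⟨g, rfl⟩ := Cohomology.mk_surjective b
  obtain ⟨d, hd, hS, hT⟩ := exists_derivation ((mem_cocycles_one_iff _).1 f.2)
    ((mem_cocycles_one_iff _).1 g.2)
  refine ⟨Cohomology.mk ρ 1 ⟨fun x => d (x 0), (mem_cocycles_one_iff ρ).2 hd⟩, Prod.ext ?_ ?_⟩
  · refine congrArg (Cohomology.mk _ 1) (Subtype.ext (funext fun x => (hS _).trans ?_))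
    rw [const_apply_zero]
  · refine congrArg (Cohomology.mk _ 1) (Subtype.ext (funext fun x => (hT _).trans ?_))
    rw [const_apply_zero]

variable (ρ)

theorem restrict_succ_bijective {n : ℕ}
    (h : Function.Bijective (restrict (shiftModule ρ) (n + 1))) :
    Function.Bijective (restrict ρ (n + 2)) := by
  have hU := (RightCoords.id (FreeProduct S T)).cohomology_shift_bijective ρ n
  have hS := (rightCoordsInl S T).cohomology_shift_bijective ρ n
  have hT := (rightCoordsInr S T).cohomology_shift_bijective ρ n
  have hcomm : restrict ρ (n + 2) ∘ Cohomology.shift ρ (MulHom.id _) n =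
      Prod.map (Cohomology.shift ρ (inl S T) n) (Cohomology.shift ρ (inr S T) n) ∘
        restrict (shiftModule ρ) (n + 1) :=
    funext fun a => Prod.ext (Cohomology.restrict_shift ρ (inl S T) n a)
      (Cohomology.restrict_shift ρ (inr S T) n a)
  rw [← Function.Bijective.of_comp_iff _ hU, hcomm]
  exact (hS.prodMap hT).comp h

theorem restrict_bijective_of_invariantsSpan.{u, v, w} {S : Type u} {T : Type v} [Semigroup S]
    [Semigroup T] {M : Type (max u v w)} [AddCommGroup M]
    {ρ : ModuleStructure (FreeProduct S T) M} (hρ : InvariantsSpan ρ) (n : ℕ) :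
    Function.Bijective (restrict ρ (n + 1)) := by
  induction n generalizing M with
  | zero => exact ⟨restrict_one_injective hρ, restrict_one_surjective⟩
  | succ n ih => exact restrict_succ_bijective _ (ih (invariantsSpan_shiftModule ρ))

theorem restrict_bijective {n : ℕ} (hn : 2 ≤ n) : Function.Bijective (restrict ρ n) := by
  obtain ⟨m, rfl⟩ := Nat.exists_eq_add_of_le' hn
  exact restrict_succ_bijective ρ <|
    restrict_bijective_of_invariantsSpan (invariantsSpan_shiftModule ρ) m

end FreeProduct

end EMCohomology

theorem theorem6 {S T A : Type*} [Semigroup S] [Semigroup T] [AddCommGroup A]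
    (ρ : EMCohomology.ModuleStructure (EMCohomology.FreeProduct S T) A)
    (n : ℕ) (hn : 2 ≤ n) :
    Nonempty
      (EMCohomology.Cohomology ρ n ≃+
        EMCohomology.Cohomology (ρ.comp (EMCohomology.FreeProduct.inl S T)) n ×
          EMCohomology.Cohomology (ρ.comp (EMCohomology.FreeProduct.inr S T)) n) := by
  exact ⟨AddEquiv.ofBijective (EMCohomology.FreeProduct.restrict ρ n)
    (EMCohomology.FreeProduct.restrict_bijective ρ hn)⟩
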